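/- Let $k$ be a field of characteristic zero and let $(V,\cdot)$ be a shuffle algebra over $k$, i.e. a (non-unital) associative $k$-algebra whose product splits as $x\cdot y=x\prec y+x\succ y$ into two bilinear products satisfying $(x\prec y)\prec z=x\prec(y\cdot z)$, $(x\succ y)\prec z=x\succ(y\prec z)$ and $(x\cdot y)\succ z=x\succ(y\succ z)$. View $V$ as a left pre-Lie algebra with $x\triangleright y:=x\succ y-y\prec x$. Let $k[V]$ be the polynomial (symmetric) algebra over the vector space $V$, with brace map $k[V]\otimes V\to V$, $P\otimes v\mapsto\{P\}v$, determined by $\{1\}v=v$, $\{w\}v=w\triangleright v$ and $$\{w_1\cdots w_n\}v=\{w_n\}(\{w_1\cdots w_{n-1}\}v)-\sum_{i=1}^{n-1}\{w_1\cdots(\{w_n\}w_i)\cdots w_{n-1}\}v ,$$ and with the Oudom--Guin product $$(w_1\cdots w_m)\ast(v_1\cdots v_n)=\sum_f W_0\,(\{W_1\}v_1)\cdots(\{W_n\}v_n),$$ where $f$ runs over all maps $\{1,\dots,m\}\to\{0,\dots,n\}$ and $W_i=\prod_{j\in f^{-1}(i)}w_j$. Let $k[V]^+$ be the ideal of polynomials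 without constant term. Then there is a unique $k$-algebra map $\iota:(k[V]^+,\ast)\to(V,\cdot)$ that restricts to the identity on $V$ (the canonical map), and for all $n\ge 1$ and $v_1,\dots,v_n\in V$ it sends the monomial $v_1\cdots v_n$ to the time-ordered product: $$\iota(v_1\cdots v_n)=T[v_1,\dots,v_n]:=\sum_{\sigma\in S_n}v_{\sigma(1)}\prec(v_{\sigma(2)}\prec(\cdots\prec(v_{\sigma(n-1)}\prec v_{\sigma(n)})\cdots)).$$ -/

import Mathlib

noncomputable section

namespace OudomGuin

open TensorProduct

section Brace

variable (k L : Type*) [CommRing k] [LeftPreLieRing L] [LeftPreLieAlgebra k L]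

/-- Left multiplication `w ↦ (v ↦ w ▷ v)` of a pre-Lie algebra (whose product is written `*`). -/
def leftMul : L →ₗ[k] Module.End k L := LinearMap.mul k L

@[simp] theorem leftMul_apply (w v : L) : leftMul k L w v = w * v := rfl

variable {L} in
/-- `(M, w) ↦ ∑ i, M (…, w ▷ w_i, …)`. -/
def multiDeriv {E : Type*} [AddCommGroup E] [Module k E] {n : ℕ}
    (M : MultilinearMap k (fun _ : Fin n => L) E) :
    L →ₗ[k] MultilinearMap k (fun _ : Fin n => L) E where
  toFun w := ∑ i, M.compLinearMap (Function.update (fun _ => LinearMap.id) i (leftMul k L w))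
  map_add' a b := by
    ext v
    simp only [sum_apply, add_apply,
      MultilinearMap.compLinearMap_apply, ← Finset.sum_add_distrib]
    refine Finset.sum_congr rfl fun i _ => ?_
    have h : ∀ w : L, (fun j => (Function.update (fun _ => LinearMap.id) i (leftMul k L w) :
        Fin n → (L →ₗ[k] L)) j (v j)) = Function.update v i (w * v i) := by
      intro w
      ext j
      by_cases hj : j = i
      · subst hj; simp
      · simp [hj]
    simp only [h, add_mul, MultilinearMap.map_update_add]
  map_smul' c a := by
    ext v
    simp only [sum_apply, smul_apply,
      MultilinearMap.compLinearMap_apply, Finset.smul_sum, RingHom.id_apply]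
    refine Finset.sum_congr rfl fun i _ => ?_
    have h : ∀ w : L, (fun j => (Function.update (fun _ => LinearMap.id) i (leftMul k L w) :
        Fin n → (L →ₗ[k] L)) j (v j)) = Function.update v i (w * v i) := by
      intro w
      ext j
      by_cases hj : j = i
      · subst hj; simp
      · simp [hj]
    simp only [h, smul_mul_assoc, MultilinearMap.map_update_smul]

theorem multiDeriv_apply {E : Type*} [AddCommGroup E] [Module k E] {n : ℕ}
    (M : MultilinearMap k (fun _ : Fin n => L) E) (w : L) (v : Fin n → L) :
    multiDeriv k M w v = ∑ i, M (Function.update v i (w * v i)) := by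
  simp only [multiDeriv, LinearMap.coe_mk, AddHom.coe_mk, sum_apply,
    MultilinearMap.compLinearMap_apply]
  refine Finset.sum_congr rfl fun i _ => ?_
  congr 1
  ext j
  by_cases hj : j = i
  · subst hj; simp
  · simp [hj]

/-- The braces as multilinear maps: `{} v = v` and
`{w, w_1, …, w_n} v = w ▷ {w_1, …, w_n} v - ∑ i, {w_1, …, w ▷ w_i, …, w_n} v`. -/
def multiBrace : (n : ℕ) → MultilinearMap k (fun _ : Fin n => L) (Module.End k L)
  | 0 => MultilinearMap.constOfIsEmpty k _ LinearMap.id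
  | n + 1 => LinearMap.uncurryLeft (M := fun _ : Fin (n + 1) => L)
      { toFun := fun w => (LinearMap.mulLeft k (leftMul k L w)).compMultilinearMap (multiBrace n)
          - multiDeriv k (multiBrace n) w
        map_add' := fun a b => by
          ext v x
          simp only [map_add, sub_apply, add_apply,
            LinearMap.compMultilinearMap_apply, LinearMap.mulLeft_apply, add_mul,
            LinearMap.sub_apply, LinearMap.add_apply]
          abel
        map_smul' := fun c a => by
          ext v x
          simp [smul_sub] }

theorem multiBrace_cons {n : ℕ} (w : L) (v : Fin n → L) :
    multiBrace k L (n + 1) (Fin.cons w v : Fin (n + 1) → L) =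
      leftMul k L w * multiBrace k L n v
        - ∑ i, multiBrace k L n (Function.update v i (w * v i)) := by
  simp [multiBrace, LinearMap.uncurryLeft_apply, multiDeriv_apply]

/-- The braces on the tensor algebra. -/
def tensorBrace : TensorAlgebra k L →ₗ[k] Module.End k L :=
  (DirectSum.toModule k ℕ _ fun n => PiTensorProduct.lift (multiBrace k L n)) ∘ₗ
    (TensorAlgebra.equivDirectSum (R := k) (M := L)).toLinearMap

theorem tensorBrace_tprod {n : ℕ} (v : Fin n → L) :
    tensorBrace k L (TensorAlgebra.tprod k L n v) = multiBrace k L n v := by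
  have h : (TensorAlgebra.equivDirectSum (R := k) (M := L)) (TensorAlgebra.tprod k L n v) =
      DirectSum.lof k ℕ (fun n => TensorPower k n L) n (PiTensorProduct.tprod k v) :=
    TensorAlgebra.toDirectSum_tensorPower_tprod v
  simp only [tensorBrace, LinearMap.comp_apply, AlgEquiv.toLinearMap_apply, h]
  rw [DirectSum.toModule_lof]
  simp

variable {k L} in
theorem tensor_ext {M : Type*} [AddCommGroup M] [Module k M] {f g : TensorAlgebra k L →ₗ[k] M}
    (h : ∀ n v, f (TensorAlgebra.tprod k L n v) = g (TensorAlgebra.tprod k L n v)) : f = g := by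
  have key : f ∘ₗ (TensorAlgebra.ofDirectSum (R := k) (M := L)).toLinearMap =
      g ∘ₗ (TensorAlgebra.ofDirectSum (R := k) (M := L)).toLinearMap := by
    refine DirectSum.linearMap_ext k fun n => PiTensorProduct.ext ?_
    ext v
    have := TensorAlgebra.ofDirectSum_of_tprod (R := k) v
    rw [← DirectSum.lof_eq_of k] at this
    simp only [LinearMap.compMultilinearMap_apply, LinearMap.comp_apply,
      AlgHom.toLinearMap_apply, this, h]
  ext1 x
  obtain ⟨y, rfl⟩ := (TensorAlgebra.equivDirectSum (R := k) (M := L)).symm.surjective x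
  exact LinearMap.congr_fun key y

variable {L} in
theorem preLie_identity (a b v : L) : a * (b * v) - b * (a * v) = a * b * v - b * a * v := by
  have h := LeftPreLieRing.assoc_symm a b v
  simp only [associator] at h
  rw [← sub_eq_zero] at h ⊢
  rw [← neg_eq_zero, ← h]
  abel

/-- The algebra map `x ↦ (x, D_w x)` to square-zero pairs, as operators on pairs. -/
def tensorDerivAux (w : L) :
    TensorAlgebra k L →ₐ[k] Module.End k (TensorAlgebra k L × TensorAlgebra k L) :=
  TensorAlgebra.lift k
    { toFun := fun v =>
        (LinearMap.mulLeft k (TensorAlgebra.ι k v) ∘ₗ LinearMap.fst k _ _).prod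
          (LinearMap.mulLeft k (TensorAlgebra.ι k (w * v)) ∘ₗ LinearMap.fst k _ _ +
            LinearMap.mulLeft k (TensorAlgebra.ι k v) ∘ₗ LinearMap.snd k _ _)
      map_add' := fun a b => by
        refine LinearMap.ext fun p => Prod.ext ?_ ?_
        · simp [add_mul]
        · simp [add_mul, mul_add]; abel
      map_smul' := fun c a => by
        refine LinearMap.ext fun p => Prod.ext ?_ ?_
        · simp
        · simp [mul_smul_comm] }

/-- The derivation of the tensor algebra extending `v ↦ w ▷ v`. -/
def tensorDeriv (w : L) : TensorAlgebra k L →ₗ[k] TensorAlgebra k L :=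
  LinearMap.snd k _ _ ∘ₗ LinearMap.applyₗ (1, 0) ∘ₗ (tensorDerivAux k L w).toLinearMap

theorem tensorDerivAux_apply (w : L) (x : TensorAlgebra k L)
    (p : TensorAlgebra k L × TensorAlgebra k L) :
    tensorDerivAux k L w x p = (x * p.1, tensorDeriv k L w x * p.1 + x * p.2) := by
  have aux : ∀ x : TensorAlgebra k L, ∃ d, ∀ p, tensorDerivAux k L w x p =
      (x * p.1, d * p.1 + x * p.2) := by
    intro x
    induction x using TensorAlgebra.induction with
    | algebraMap r =>
      refine ⟨0, fun p => ?_⟩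
      simp [Algebra.smul_def, Module.algebraMap_end_apply, Prod.ext_iff]
    | ι v => exact ⟨TensorAlgebra.ι k (w * v), fun p => by simp [tensorDerivAux]⟩
    | mul x y hx hy =>
      obtain ⟨d, hd⟩ := hx
      obtain ⟨e, he⟩ := hy
      refine ⟨d * y + x * e, fun p => ?_⟩
      rw [map_mul, Module.End.mul_apply, he, hd]
      simp only [mul_assoc, add_mul, mul_add, add_assoc]
    | add x y hx hy =>
      obtain ⟨d, hd⟩ := hx
      obtain ⟨e, he⟩ := hy
      refine ⟨d + e, fun p => ?_⟩
      rw [map_add, LinearMap.add_apply, he, hd]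
      refine Prod.ext ?_ ?_
      · simp [add_mul]
      · simp only [Prod.snd_add, add_mul]; abel
  obtain ⟨d, hd⟩ := aux x
  have : tensorDeriv k L w x = d := by
    simp [tensorDeriv, hd]
  rw [hd, this]

@[simp] theorem tensorDeriv_ι (w v : L) :
    tensorDeriv k L w (TensorAlgebra.ι k v) = TensorAlgebra.ι k (w * v) := by
  simp [tensorDeriv, tensorDerivAux]

theorem tensorDeriv_mul (w : L) (x y : TensorAlgebra k L) :
    tensorDeriv k L w (x * y) = tensorDeriv k L w x * y + x * tensorDeriv k L w y := by
  have h := tensorDerivAux_apply k L w (x * y) (1, 0)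
  rw [map_mul, Module.End.mul_apply, tensorDerivAux_apply, tensorDerivAux_apply] at h
  simpa using (congrArg Prod.snd h).symm

@[simp] theorem tensorDeriv_one (w : L) : tensorDeriv k L w 1 = 0 := by
  have h := tensorDeriv_mul k L w 1 1
  simpa using h

theorem tensorDeriv_tprod (w : L) : ∀ (n : ℕ) (v : Fin n → L),
    tensorDeriv k L w (TensorAlgebra.tprod k L n v) =
      ∑ i, TensorAlgebra.tprod k L n (Function.update v i (w * v i))
  | 0, v => by simp [TensorAlgebra.tprod_apply]
  | n + 1, v => by
    have hcons : ∀ u : Fin (n + 1) → L, TensorAlgebra.tprod k L (n + 1) u =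
        TensorAlgebra.ι k (u 0) * TensorAlgebra.tprod k L n (fun i => u i.succ) := by
      intro u
      simp [TensorAlgebra.tprod_apply, List.ofFn_succ]
    rw [hcons, tensorDeriv_mul, tensorDeriv_tprod w n, Fin.sum_univ_succ, Finset.mul_sum]
    congr 1
    · simp [hcons]
    · refine Finset.sum_congr rfl fun i _ => ?_
      rw [hcons, Function.update_of_ne (Fin.succ_ne_zero i).symm]
      congr 2
      ext j
      by_cases hj : j = i
      · subst hj; simp
      · rw [Function.update_of_ne hj, Function.update_of_ne (by simpa using hj)]

theorem tensorDeriv_comm (a b : L) (x : TensorAlgebra k L) :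
    tensorDeriv k L a (tensorDeriv k L b x) - tensorDeriv k L b (tensorDeriv k L a x) =
      tensorDeriv k L (a * b) x - tensorDeriv k L (b * a) x := by
  induction x using TensorAlgebra.induction with
  | algebraMap r => simp [Algebra.algebraMap_eq_smul_one]
  | ι v =>
    simp only [tensorDeriv_ι, ← map_sub, preLie_identity]
  | mul x y hx hy =>
    simp only [tensorDeriv_mul, map_add]
    have e1 := congrArg (· * y) hx
    have e2 := congrArg (x * ·) hy
    simp only [sub_mul, mul_sub] at e1 e2
    have e3 := congrArg₂ (· + ·) e1 e2
    rw [← sub_eq_zero] at e3 ⊢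
    rw [← e3]
    abel
  | add x y hx hy =>
    simp only [map_add]
    rw [add_sub_add_comm, hx, hy]
    abel

theorem tensorBrace_ι_mul (w : L) (t : TensorAlgebra k L) :
    tensorBrace k L (TensorAlgebra.ι k w * t) =
      leftMul k L w * tensorBrace k L t - tensorBrace k L (tensorDeriv k L w t) := by
  have : tensorBrace k L ∘ₗ LinearMap.mulLeft k (TensorAlgebra.ι k w) =
      LinearMap.mulLeft k (leftMul k L w) ∘ₗ tensorBrace k L -
        tensorBrace k L ∘ₗ tensorDeriv k L w := by
    refine tensor_ext fun n v => ?_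
    have hc : TensorAlgebra.ι k w * TensorAlgebra.tprod k L n v =
        TensorAlgebra.tprod k L (n + 1) (Fin.cons w v : Fin (n + 1) → L) := by
      simp [TensorAlgebra.tprod_apply, List.ofFn_succ]
    simp only [LinearMap.comp_apply, LinearMap.sub_apply, LinearMap.mulLeft_apply, hc,
      tensorBrace_tprod, multiBrace_cons, tensorDeriv_tprod, map_sum]
  exact LinearMap.congr_fun this t

theorem tensorDeriv_mem_pow (w : L) : ∀ (n : ℕ) (x : TensorAlgebra k L),
    x ∈ (LinearMap.range (TensorAlgebra.ι k (M := L))) ^ n →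
      tensorDeriv k L w x ∈ (LinearMap.range (TensorAlgebra.ι k (M := L))) ^ n
  | 0, x, hx => by
    rw [pow_zero, Submodule.mem_one] at hx
    obtain ⟨r, rfl⟩ := hx
    simp [Algebra.algebraMap_eq_smul_one]
  | n + 1, x, hx => by
    rw [pow_succ'] at hx
    induction hx using Submodule.mul_induction_on' with
    | mem_mul_mem a ha y hy =>
      obtain ⟨v, rfl⟩ := ha
      rw [tensorDeriv_mul, tensorDeriv_ι, pow_succ']
      exact add_mem (Submodule.mul_mem_mul ⟨_, rfl⟩ hy)
        (Submodule.mul_mem_mul ⟨_, rfl⟩ (tensorDeriv_mem_pow w n y hy))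
    | add x _ y _ hx hy => rw [map_add]; exact add_mem hx hy

theorem tensorBrace_comm_one (a b : L) (y : TensorAlgebra k L) :
    tensorBrace k L (TensorAlgebra.ι k a * (TensorAlgebra.ι k b * y)) =
      tensorBrace k L (TensorAlgebra.ι k b * (TensorAlgebra.ι k a * y)) := by
  simp only [tensorBrace_ι_mul, tensorDeriv_mul, tensorDeriv_ι, map_add]
  have h := congrArg (tensorBrace k L) (tensorDeriv_comm k L a b y)
  simp only [map_sub] at h
  have h2 : leftMul k L a * leftMul k L b - leftMul k L b * leftMul k L a =
      leftMul k L (a * b) - leftMul k L (b * a) := by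
    ext v
    simp only [LinearMap.sub_apply, Module.End.mul_apply, leftMul_apply, preLie_identity]
  have h3 := congrArg (· * tensorBrace k L y) h2
  simp only [sub_mul] at h3
  simp only [mul_sub, ← mul_assoc]
  rw [← sub_eq_zero] at h h3 ⊢
  have := congrArg₂ (· - ·) h3 h
  simp only [sub_zero] at this
  rw [← this]
  abel

theorem tensorBrace_comm_aux : ∀ (n : ℕ) (x : TensorAlgebra k L),
    x ∈ (LinearMap.range (TensorAlgebra.ι k (M := L))) ^ n → ∀ (a b : L) (y : TensorAlgebra k L),
    tensorBrace k L (x * (TensorAlgebra.ι k a * (TensorAlgebra.ι k b * y))) =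
      tensorBrace k L (x * (TensorAlgebra.ι k b * (TensorAlgebra.ι k a * y)))
  | 0, x, hx, a, b, y => by
    rw [pow_zero, Submodule.mem_one] at hx
    obtain ⟨r, rfl⟩ := hx
    simp [Algebra.algebraMap_eq_smul_one, tensorBrace_comm_one]
  | n + 1, x, hx, a, b, y => by
    rw [pow_succ'] at hx
    induction hx using Submodule.mul_induction_on' with
    | mem_mul_mem c hc x' hx' =>
      obtain ⟨w, rfl⟩ := hc
      have ih := tensorBrace_comm_aux n
      simp only [mul_assoc, tensorBrace_ι_mul k L w]
      rw [ih x' hx']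
      simp only [tensorDeriv_mul, tensorDeriv_ι, mul_add, map_add]
      rw [ih _ (tensorDeriv_mem_pow k L w n x' hx') a b y, ih x' hx' (w * a) b y,
        ih x' hx' a (w * b) y, ih x' hx' a b (tensorDeriv k L w y)]
      abel
    | add x _ y _ hx hy => simp only [add_mul, map_add, hx, hy]

theorem tensorBrace_comm (x : TensorAlgebra k L) (a b : L) (y : TensorAlgebra k L) :
    tensorBrace k L (x * (TensorAlgebra.ι k a * (TensorAlgebra.ι k b * y))) =
      tensorBrace k L (x * (TensorAlgebra.ι k b * (TensorAlgebra.ι k a * y))) := by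
  have hx : x ∈ (⨆ n : ℕ, (LinearMap.range (TensorAlgebra.ι k (M := L))) ^ n) := by
    rw [(DirectSum.Decomposition.isInternal
      (fun n : ℕ => (LinearMap.range (TensorAlgebra.ι k (M := L))) ^ n)).submodule_iSup_eq_top]
    trivial
  induction hx using Submodule.iSup_induction' with
  | mem n x hx => exact tensorBrace_comm_aux k L n x hx a b y
  | zero => simp
  | add x y _ _ hx hy => simp only [add_mul, map_add, hx, hy]

/-- Tensors that the braces do not distinguish, in any context. -/
def braceCon : RingCon (TensorAlgebra k L) where
  r a b := ∀ x y, tensorBrace k L (x * a * y) = tensorBrace k L (x * b * y)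
  iseqv := ⟨fun _ _ _ => rfl, fun h x y => (h x y).symm, fun h h' x y => (h x y).trans (h' x y)⟩
  add' h h' x y := by simp only [mul_add, add_mul, map_add, h x y, h' x y]
  mul' {a b c d} h h' x y := by
    rw [← mul_assoc, h' (x * a) y, mul_assoc x a d, mul_assoc x (a * d) y, mul_assoc a d y,
      ← mul_assoc x a, h x (d * y)]
    simp only [mul_assoc]

theorem tensorBrace_eq_of_symRingCon (a b : TensorAlgebra k L)
    (h : TensorAlgebra.symRingCon k L a b) : tensorBrace k L a = tensorBrace k L b := by
  have hle : TensorAlgebra.symRingCon k L ≤ braceCon k L := by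
    refine RingCon.ringConGen_le.2 fun u v huv => ?_
    induction huv with
    | mul_comm p q =>
      intro x y
      simpa only [mul_assoc] using tensorBrace_comm k L x p q y
  simpa using hle h 1 1

/-- The brace map `P ⊗ v ↦ {P} v` of a pre-Lie algebra, as a linear map from polynomials
to endomorphisms: the unique linear map with `{1} v = v` and the recursion
`OudomGuin.brace_prod_snoc`. -/
def brace : SymmetricAlgebra k L →ₗ[k] Module.End k L where
  toFun x := Quotient.lift (s := (TensorAlgebra.symRingCon k L).toSetoid) (tensorBrace k L)
    (tensorBrace_eq_of_symRingCon k L) x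
  map_add' := by rintro ⟨x⟩ ⟨y⟩; exact map_add (tensorBrace k L) x y
  map_smul' := by rintro c ⟨x⟩; exact map_smul (tensorBrace k L) c x

theorem brace_algHom (t : TensorAlgebra k L) :
    brace k L (SymmetricAlgebra.algHom k L t) = tensorBrace k L t := rfl

theorem algHom_tprod {n : ℕ} (v : Fin n → L) :
    SymmetricAlgebra.algHom k L (TensorAlgebra.tprod k L n v) =
      ∏ i, SymmetricAlgebra.ι k L (v i) := by
  rw [TensorAlgebra.tprod_apply, map_list_prod, List.map_ofFn, List.prod_ofFn]
  rfl

theorem brace_one (v : L) : brace k L 1 v = v := by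
  have h := tensorBrace_tprod k L (n := 0) Fin.elim0
  rw [← brace_algHom, algHom_tprod] at h
  simp only [Finset.univ_eq_empty, Finset.prod_empty] at h
  rw [h]
  rfl

/-- `{w_1, …, w_{n+1}} v = {w_{n+1}} ({w_1, …, w_n} v)
  - ∑ i, {w_1, …, {w_{n+1}} w_i, …, w_n} v`. -/
theorem brace_prod_snoc {n : ℕ} (w : Fin (n + 1) → L) (v : L) :
    brace k L (∏ i, SymmetricAlgebra.ι k L (w i)) v =
      w (Fin.last n) * brace k L (∏ i : Fin n, SymmetricAlgebra.ι k L (w i.castSucc)) v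
        - ∑ i : Fin n, brace k L (∏ j, SymmetricAlgebra.ι k L
            (Function.update (fun l : Fin n => w l.castSucc) i
              (w (Fin.last n) * w i.castSucc) j)) v := by
  have h := tensorBrace_ι_mul k L (w (Fin.last n))
    (TensorAlgebra.tprod k L n (fun i => w i.castSucc))
  rw [tensorDeriv_tprod, ← brace_algHom, ← brace_algHom, ← brace_algHom, map_mul, map_sum,
    algHom_tprod] at h
  simp only [algHom_tprod, map_sum] at h
  have hι : SymmetricAlgebra.algHom k L (TensorAlgebra.ι k (w (Fin.last n))) =
      SymmetricAlgebra.ι k L (w (Fin.last n)) := rfl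
  rw [hι] at h
  rw [Fin.prod_univ_castSucc, mul_comm]
  have h' := LinearMap.congr_fun h v
  simpa only [LinearMap.sub_apply, Module.End.mul_apply, leftMul_apply,
    LinearMap.sum_apply] using h'

theorem brace_ι (w v : L) : brace k L (SymmetricAlgebra.ι k L w) v = w * v := by
  have h := brace_prod_snoc k L (fun _ : Fin 1 => w) v
  simpa [brace_one] using h

end Brace

section Product

open WithConv

variable (k L : Type*) [CommRing k] [LeftPreLieRing L] [LeftPreLieAlgebra k L]

/-- For `v ∈ L` the map `P ↦ {P} v` is an element of the commutative algebra of linear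
endomorphisms of `k[L]` with its convolution product
`(f * g)(P) = ∑ f(P_(1)) g(P_(2))`; this is the extension of `v ↦ {·} v` to an algebra map on
`k[L]`, that is `Q = v_1 ⋯ v_n ↦ (P ↦ ∑ {P_(1)} v_1 ⋯ {P_(n)} v_n)`. -/
def action : SymmetricAlgebra k L →ₐ[k]
    WithConv (SymmetricAlgebra k L →ₗ[k] SymmetricAlgebra k L) :=
  SymmetricAlgebra.lift
    { toFun := fun v => toConv (SymmetricAlgebra.ι k L ∘ₗ (brace k L).flip v)
      map_add' := fun a b => by ext; simp
      map_smul' := fun c a => by ext; simp }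

variable {k L} in
/-- The Oudom-Guin product `P ∗ Q = ∑ P_(0) {P_(1)} v_1 ⋯ {P_(n)} v_n`, for `Q = v_1 ⋯ v_n`.
See `OudomGuin.ogMul_prod_prod` for the explicit formula on monomials. -/
def ogMul (P Q : SymmetricAlgebra k L) : SymmetricAlgebra k L :=
  (toConv LinearMap.id * action k L Q).ofConv P

variable {k L}

theorem action_ι_apply (v : L) (P : SymmetricAlgebra k L) :
    action k L (SymmetricAlgebra.ι k L v) P = SymmetricAlgebra.ι k L (brace k L P v) := by
  simp [action]

theorem ogMul_add (P Q R : SymmetricAlgebra k L) : ogMul P (Q + R) = ogMul P Q + ogMul P R := by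
  simp [ogMul, mul_add]

theorem add_ogMul (P Q R : SymmetricAlgebra k L) : ogMul (P + Q) R = ogMul P R + ogMul Q R := by
  simp [ogMul]

theorem ogMul_smul (c : k) (P Q : SymmetricAlgebra k L) : ogMul P (c • Q) = c • ogMul P Q := by
  simp only [ogMul, map_smul, mul_smul_comm]
  rfl

theorem smul_ogMul (c : k) (P Q : SymmetricAlgebra k L) : ogMul (c • P) Q = c • ogMul P Q := by
  simp [ogMul]

/-- Precomposition with multiplication by `w`; a derivation for the convolution product. -/
def shift (w : L) (g : WithConv (SymmetricAlgebra k L →ₗ[k] SymmetricAlgebra k L)) :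
    WithConv (SymmetricAlgebra k L →ₗ[k] SymmetricAlgebra k L) :=
  toConv (g.ofConv ∘ₗ LinearMap.mulLeft k (SymmetricAlgebra.ι k L w))

theorem shift_apply (w : L) (g : WithConv (SymmetricAlgebra k L →ₗ[k] SymmetricAlgebra k L))
    (P : SymmetricAlgebra k L) : shift w g P = g (SymmetricAlgebra.ι k L w * P) := rfl

theorem shift_mul (w : L) (g h : WithConv (SymmetricAlgebra k L →ₗ[k] SymmetricAlgebra k L)) :
    shift w (g * h) = shift w g * h + g * shift w h := by
  ext P
  change (g * h) (SymmetricAlgebra.ι k L w * P) = (shift w g * h) P + (g * shift w h) P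
  rw [LinearMap.convMul_apply, LinearMap.convMul_apply, LinearMap.convMul_apply,
    Bialgebra.comul_mul, SymmetricAlgebra.comul_ι]
  induction Coalgebra.comul (R := k) P using TensorProduct.induction_on with
  | zero => simp
  | tmul x y => simp [shift, add_mul]
  | add x y hx hy => simp only [mul_add, map_add, hx, hy]; abel

theorem shift_one (w : L) :
    shift w (1 : WithConv (SymmetricAlgebra k L →ₗ[k] SymmetricAlgebra k L)) = 0 := by
  ext P
  change (1 : WithConv (SymmetricAlgebra k L →ₗ[k] SymmetricAlgebra k L))
    (SymmetricAlgebra.ι k L w * P) = 0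
  rw [LinearMap.convOne_apply, Bialgebra.counit_mul, SymmetricAlgebra.counit_ι]
  simp

theorem shift_prod (w : L) : ∀ (N : ℕ)
    (g : Fin N → WithConv (SymmetricAlgebra k L →ₗ[k] SymmetricAlgebra k L)),
    shift w (∏ i, g i) = ∑ i, ∏ j, Function.update g i (shift w (g i)) j
  | 0, g => by simp [shift_one]
  | N + 1, g => by
    rw [Fin.prod_univ_succ, shift_mul, shift_prod w N, Fin.sum_univ_succ, Finset.mul_sum]
    congr 1
    · simp [Fin.prod_univ_succ]
    · refine Finset.sum_congr rfl fun i _ => ?_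
      rw [Fin.prod_univ_succ, Function.update_of_ne (Fin.succ_ne_zero i).symm]
      congr 1
      refine Finset.prod_congr rfl fun j _ => ?_
      by_cases hj : j = i
      · subst hj; simp
      · rw [Function.update_of_ne hj, Function.update_of_ne (by simpa using hj)]

theorem conv_prod_one (N : ℕ)
    (g : Fin N → WithConv (SymmetricAlgebra k L →ₗ[k] SymmetricAlgebra k L)) :
    (∏ i, g i) 1 = ∏ i, g i 1 := by
  induction N with
  | zero => simp [LinearMap.convOne_apply]
  | succ N ih =>
    rw [Fin.prod_univ_succ, Fin.prod_univ_succ, LinearMap.convMul_apply, Bialgebra.comul_one,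
      Algebra.TensorProduct.one_def]
    simp [ih]

theorem conv_prod_prod (N : ℕ) : ∀ (m : ℕ) (w : Fin m → L)
    (g : Fin N → WithConv (SymmetricAlgebra k L →ₗ[k] SymmetricAlgebra k L)),
    (∏ i, g i) (∏ j, SymmetricAlgebra.ι k L (w j)) =
      ∑ f : Fin m → Fin N, ∏ i, g i (∏ j with f j = i, SymmetricAlgebra.ι k L (w j))
  | 0, w, g => by
    simp [conv_prod_one]
  | m + 1, w, g => by
    rw [Fin.prod_univ_succ, ← shift_apply, shift_prod]
    rw [← (Fin.consEquiv (fun _ : Fin (m + 1) => Fin N)).sum_comp, Fintype.sum_prod_type,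
      ofConv_sum, LinearMap.sum_apply]
    refine Finset.sum_congr rfl fun a _ => ?_
    rw [conv_prod_prod N m]
    refine Finset.sum_congr rfl fun f _ => Finset.prod_congr rfl fun i _ => ?_
    simp only [Finset.prod_filter, Fin.prod_univ_succ, Fin.consEquiv_apply, Fin.cons_zero,
      Fin.cons_succ]
    by_cases h : a = i
    · subst h
      simp [shift_apply]
    · rw [Function.update_of_ne (Ne.symm h)]
      simp [h]

/-- `(w_1 ⋯ w_m) ∗ (v_1 ⋯ v_n) = ∑_f W_0 ({W_1} v_1) ⋯ ({W_n} v_n)`, where `f` runs over all maps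
`{1, …, m} → {0, …, n}` and `W_i = ∏_{f j = i} w_j`. -/
theorem ogMul_prod_prod {m n : ℕ} (w : Fin m → L) (v : Fin n → L) :
    ogMul (∏ j, SymmetricAlgebra.ι k L (w j)) (∏ i, SymmetricAlgebra.ι k L (v i)) =
      ∑ f : Fin m → Fin (n + 1), (∏ j with f j = 0, SymmetricAlgebra.ι k L (w j)) *
        ∏ i : Fin n, SymmetricAlgebra.ι k L
          (brace k L (∏ j with f j = i.succ, SymmetricAlgebra.ι k L (w j)) (v i)) := by
  have h := conv_prod_prod (n + 1) m w (Fin.cons (toConv LinearMap.id)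
    (fun i => action k L (SymmetricAlgebra.ι k L (v i))))
  simp only [Fin.prod_univ_succ, Fin.cons_zero, Fin.cons_succ, action_ι_apply] at h
  rw [ogMul, map_prod (action k L), h]
  rfl

theorem algebraMapInv_conv (Q : SymmetricAlgebra k L) :
    ∀ (g : WithConv (SymmetricAlgebra k L →ₗ[k] SymmetricAlgebra k L)) (P : SymmetricAlgebra k L),
      SymmetricAlgebra.algebraMapInv ((g * action k L Q) P) =
        SymmetricAlgebra.algebraMapInv Q * SymmetricAlgebra.algebraMapInv (g P) := by
  induction Q using SymmetricAlgebra.induction with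
  | algebraMap r =>
    intro g P
    rw [Algebra.algebraMap_eq_smul_one, map_smul, map_one, mul_smul_comm, mul_one]
    simp
  | ι v =>
    intro g P
    rw [LinearMap.convMul_apply, SymmetricAlgebra.algebraMapInv_ι, zero_mul]
    induction Coalgebra.comul (R := k) P using TensorProduct.induction_on with
    | zero => simp
    | tmul x y => simp [action_ι_apply, SymmetricAlgebra.algebraMapInv_ι]
    | add x y hx hy => simp only [map_add, hx, hy, add_zero]
  | mul a b ha hb =>
    intro g P
    rw [map_mul, ← mul_assoc, hb, ha, map_mul]
    ring
  | add a b ha hb =>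
    intro g P
    rw [map_add, mul_add, map_add, add_mul, ← ha, ← hb, ← map_add]
    rfl

variable (k L) in
/-- The augmentation ideal `k[L]^+`: the polynomials without constant term. -/
def augmentationIdeal : Ideal (SymmetricAlgebra k L) :=
  RingHom.ker (SymmetricAlgebra.algebraMapInv (R := k) (M := L))

theorem ogMul_mem (P : SymmetricAlgebra k L) {Q : SymmetricAlgebra k L}
    (hQ : Q ∈ augmentationIdeal k L) : ogMul P Q ∈ augmentationIdeal k L := by
  rw [augmentationIdeal, RingHom.mem_ker] at hQ ⊢
  rw [ogMul, algebraMapInv_conv, hQ, zero_mul]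

variable (k L) in
/-- The vector space `k[L]^+`, equipped below with the product `∗` of Oudom and Guin. -/
def AugmentedPoly : Type _ := augmentationIdeal k L

namespace AugmentedPoly

instance : AddCommGroup (AugmentedPoly k L) := inferInstanceAs (AddCommGroup (augmentationIdeal k L))

instance : Module k (AugmentedPoly k L) := inferInstanceAs (Module k (augmentationIdeal k L))

/-- The product of `k[L]^+` is the Oudom-Guin product `∗`. -/
instance : NonUnitalNonAssocRing (AugmentedPoly k L) where
  mul P Q := ⟨ogMul P.1 Q.1, ogMul_mem P.1 Q.2⟩
  left_distrib P Q R := Subtype.ext (ogMul_add P.1 Q.1 R.1)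
  right_distrib P Q R := Subtype.ext (add_ogMul P.1 Q.1 R.1)
  zero_mul P := Subtype.ext (by
    change ogMul 0 P.1 = 0
    simpa using smul_ogMul (0 : k) 0 P.1)
  mul_zero P := Subtype.ext (by
    change ogMul P.1 0 = 0
    simpa using ogMul_smul (0 : k) P.1 0)

theorem coe_mul (P Q : AugmentedPoly k L) : (P * Q).1 = ogMul P.1 Q.1 := rfl

variable (k) in
/-- The monomial `v_1 ⋯ v_{n+1}` (ordinary product of polynomials) as an element of `k[L]^+`. -/
def monomial {n : ℕ} (v : Fin (n + 1) → L) : AugmentedPoly k L :=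
  ⟨∏ i, SymmetricAlgebra.ι k L (v i), by
    rw [augmentationIdeal, RingHom.mem_ker, map_prod, Fin.prod_univ_succ,
      SymmetricAlgebra.algebraMapInv_ι, zero_mul]⟩

variable (k) in
/-- A vector `v ∈ L` as an element of `k[L]^+`. -/
def ofVector (v : L) : AugmentedPoly k L :=
  ⟨SymmetricAlgebra.ι k L v, SymmetricAlgebra.algebraMapInv_ι v⟩

end AugmentedPoly

end Product

end OudomGuin

/-- A shuffle (dendriform) algebra: a non-unital associative `k`-algebra whose product is the sum
of two bilinear half-shuffle products `prec` (`≺`) and `succ` (`≻`) subject to the shuffle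
relations. -/
class ShuffleAlgebra (k A : Type*) [CommRing k] [NonUnitalRing A] [Module k A] where
  /-- The left half-shuffle product `a ≺ b`. -/
  prec : A →ₗ[k] A →ₗ[k] A
  /-- The right half-shuffle product `a ≻ b`. -/
  succ : A →ₗ[k] A →ₗ[k] A
  mul_eq (a b : A) : a * b = prec a b + succ a b
  prec_prec (a b c : A) : prec (prec a b) c = prec a (b * c)
  succ_prec (a b c : A) : prec (succ a b) c = succ a (prec b c)
  mul_succ (a b c : A) : succ (a * b) c = succ a (succ b c)

namespace ShuffleAlgebra

/-- The vector space underlying a shuffle algebra `A`, equipped below with its pre-Lie product. -/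
def PreLie (_k A : Type*) : Type _ := A

section PreLie

variable (k A : Type*) [CommRing k] [NonUnitalRing A] [Module k A]

instance : AddCommGroup (PreLie k A) := inferInstanceAs (AddCommGroup A)

instance : Module k (PreLie k A) := inferInstanceAs (Module k A)

/-- The identity map from a shuffle algebra to its underlying pre-Lie algebra. -/
def toPreLie : A ≃ₗ[k] PreLie k A := LinearEquiv.refl k A

variable [ShuffleAlgebra k A]

/-- The pre-Lie product `x ▷ y = x ≻ y - y ≺ x`. -/
instance : Mul (PreLie k A) where
  mul x y := toPreLie k A (succ (k := k) ((toPreLie k A).symm x) ((toPreLie k A).symm y) -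
    prec (k := k) ((toPreLie k A).symm y) ((toPreLie k A).symm x))

variable {A} in
theorem toPreLie_mul (x y : A) : toPreLie k A x * toPreLie k A y =
    toPreLie k A (succ (k := k) x y - prec (k := k) y x) := rfl

instance : LeftPreLieRing (PreLie k A) where
  left_distrib x y z := by
    change toPreLie k A _ = toPreLie k A _ + toPreLie k A _
    rw [← map_add]; congr 1; simp only [map_add, LinearMap.add_apply]; abel
  right_distrib x y z := by
    change toPreLie k A _ = toPreLie k A _ + toPreLie k A _
    rw [← map_add]; congr 1; simp only [map_add, LinearMap.add_apply]; abel
  zero_mul x := by change toPreLie k A _ = 0; simp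
  mul_zero x := by change toPreLie k A _ = 0; simp
  assoc_symm' x y z := by
    obtain ⟨x, rfl⟩ := (toPreLie k A).surjective x
    obtain ⟨y, rfl⟩ := (toPreLie k A).surjective y
    obtain ⟨z, rfl⟩ := (toPreLie k A).surjective z
    simp only [associator, toPreLie_mul, ← map_sub]
    congr 1
    have h1 := mul_succ (k := k) x y z
    have h2 := mul_succ (k := k) y x z
    have h3 := prec_prec (k := k) z x y
    have h4 := prec_prec (k := k) z y x
    have h5 := succ_prec (k := k) x z y
    have h6 := succ_prec (k := k) y z x
    rw [mul_eq (k := k)] at h1 h2 h3 h4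
    simp only [map_add, LinearMap.add_apply] at h1 h2 h3 h4
    simp only [map_sub, LinearMap.sub_apply, h3, h4, h5, h6, ← h1, ← h2]
    abel

instance : LeftPreLieAlgebra k (PreLie k A) where
  smul_assoc c x y := by
    change toPreLie k A _ = c • toPreLie k A _
    rw [← map_smul]; congr 1; simp [smul_sub]
  smul_comm c x y := by
    change c • toPreLie k A _ = toPreLie k A _
    rw [← map_smul]; congr 1; simp [smul_sub]

end PreLie

variable (k : Type*) {A : Type*} [CommRing k] [NonUnitalRing A] [Module k A] [ShuffleAlgebra k A]

/-- `v_1 ≺ (v_2 ≺ (⋯ ≺ (v_n ≺ v_{n+1}) ⋯ ))`. -/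
def iteratedPrec : (n : ℕ) → (Fin (n + 1) → A) → A
  | 0, v => v 0
  | n + 1, v => prec (k := k) (v 0) (iteratedPrec n (Fin.tail v))

/-- The time-ordered product
`T[v_1, …, v_{n+1}] = ∑_σ v_{σ(1)} ≺ (v_{σ(2)} ≺ (⋯ ≺ (v_{σ(n)} ≺ v_{σ(n+1)}) ⋯ ))`. -/
def timeOrderedProduct {n : ℕ} (v : Fin (n + 1) → A) : A :=
  ∑ σ : Equiv.Perm (Fin (n + 1)), iteratedPrec k n (v ∘ σ)

end ShuffleAlgebra

end

/-! Write `D_w` for the derivation of `k[L]` extending `v ↦ w ▷ v`. The product `∗` is governed by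
two identities with a single vector `w` on the left: `w ∗ P = w P + D_w P` (`ι_ogMul`) and `(w P) ∗
Q = w ∗ (P ∗ Q) - (D_w P) ∗ Q` (`ι_mul_ogMul`). The second holds because, on the maps `P ↦ ∑ {P_(1)}
v_1 ⋯ {P_(n)} v_n`, precomposition with multiplication by `w` is the commutator with `D_w`
(`shift_action`): both are derivations for convolution, and on one vector the claim is the brace
recursion.

Hence a linear map `Φ` on `k[L]` with `Φ 1 = 1` and `Φ (w P) = ρ(w) Φ P - Φ (D_w P)` is
multiplicative for `∗` (`map_ogMul_of_recursion`). It exists whenever `ρ` respects Lie brackets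
(`exists_extension`): the recursion is that of the braces, so `Φ` is read off from the braces of a
larger pre-Lie algebra `L × U`. Associativity of `∗` is never needed.

For a shuffle algebra, `▷` and the associative product have the same commutator, so left
multiplication on the unitization of `V` is an admissible `ρ`. The resulting `Φ` sends `k[V]^+` into
`V`. Its values on monomials are time-ordered products because these obey the same recursion
(`timeOrderedProduct_cons`), which is where the shuffle relations enter. Uniqueness follows from `w
P = w ∗ P - D_w P`: by induction on degree, `L` generates `k[L]^+` under `∗`. -/

noncomputable section

namespace OudomGuin

open TensorProduct WithConv

/-! ### The derivation along a vector, and the recursion for `∗` -/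

section Derivation

variable {k L : Type*} [CommRing k] [LeftPreLieRing L] [LeftPreLieAlgebra k L]

variable (k L) in
/-- The identity map of `k[L]`, as an element of the convolution algebra. -/
abbrev convId : WithConv (SymmetricAlgebra k L →ₗ[k] SymmetricAlgebra k L) :=
  toConv LinearMap.id

theorem conv_apply_one (f g : WithConv (SymmetricAlgebra k L →ₗ[k] SymmetricAlgebra k L)) :
    (f * g) 1 = f 1 * g 1 := by
  rw [LinearMap.convMul_apply, Bialgebra.comul_one, Algebra.TensorProduct.one_def]
  simp

theorem action_apply_one (Q : SymmetricAlgebra k L) : action k L Q 1 = Q := by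
  induction Q using SymmetricAlgebra.induction with
  | algebraMap r =>
    rw [Algebra.algebraMap_eq_smul_one, map_smul, map_one (action k L)]
    change r • (1 : WithConv (SymmetricAlgebra k L →ₗ[k] SymmetricAlgebra k L)) 1 = r • 1
    rw [LinearMap.convOne_apply, Bialgebra.counit_one, map_one]
  | ι v => rw [action_ι_apply, brace_one]
  | mul a b ha hb => rw [map_mul, conv_apply_one, ha, hb]
  | add a b ha hb =>
    rw [map_add]
    exact congrArg₂ (· + ·) ha hb

theorem one_ogMul (Q : SymmetricAlgebra k L) : ogMul 1 Q = Q := by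
  change (convId k L * action k L Q) 1 = Q
  rw [conv_apply_one, action_apply_one]
  exact one_mul Q

/-- The derivation of `k[L]` extending `v ↦ w ▷ v`. -/
def symDeriv (w : L) : SymmetricAlgebra k L →ₗ[k] SymmetricAlgebra k L where
  toFun Q := action k L Q (SymmetricAlgebra.ι k L w)
  map_add' P Q := by rw [map_add]; rfl
  map_smul' c Q := by rw [map_smul]; rfl

theorem symDeriv_apply (w : L) (Q : SymmetricAlgebra k L) :
    symDeriv w Q = action k L Q (SymmetricAlgebra.ι k L w) := rfl

/-- Evaluation at `w` is `shift w`, a derivation for convolution, followed by evaluation at `1`,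
which is multiplicative. -/
theorem symDeriv_mul (w : L) (P Q : SymmetricAlgebra k L) :
    symDeriv w (P * Q) = symDeriv w P * Q + P * symDeriv w Q := by
  have h : ∀ R, symDeriv w R = shift w (action k L R) 1 := fun R => by
    rw [shift_apply, mul_one, symDeriv_apply]
  rw [h, map_mul, shift_mul]
  change (shift w (action k L P) * action k L Q) 1 + (action k L P * shift w (action k L Q)) 1 = _
  rw [conv_apply_one, conv_apply_one, ← h, ← h, action_apply_one, action_apply_one]

@[simp] theorem symDeriv_ι (w v : L) :
    symDeriv w (SymmetricAlgebra.ι k L v) = SymmetricAlgebra.ι k L (w * v) := by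
  rw [symDeriv_apply, action_ι_apply, brace_ι]

@[simp] theorem symDeriv_one (w : L) : symDeriv w (1 : SymmetricAlgebra k L) = 0 := by
  simpa using symDeriv_mul w (1 : SymmetricAlgebra k L) 1

@[simp] theorem symDeriv_algebraMap (w : L) (r : k) :
    symDeriv w (algebraMap k (SymmetricAlgebra k L) r) = 0 := by
  rw [Algebra.algebraMap_eq_smul_one, map_smul, symDeriv_one, smul_zero]

/-- Both sides obey the Leibniz rule and agree on generators. This carries the tensor-level formulas
for monomials and braces down to `k[L]`. -/
theorem symDeriv_algHom (w : L) (t : TensorAlgebra k L) :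
    symDeriv w (SymmetricAlgebra.algHom k L t) =
      SymmetricAlgebra.algHom k L (tensorDeriv k L w t) := by
  induction t using TensorAlgebra.induction with
  | algebraMap r =>
    rw [AlgHom.commutes, symDeriv_algebraMap, Algebra.algebraMap_eq_smul_one, map_smul,
      tensorDeriv_one, smul_zero, map_zero]
  | ι v =>
    rw [tensorDeriv_ι]
    exact symDeriv_ι w v
  | mul x y hx hy => rw [map_mul, symDeriv_mul, hx, hy, tensorDeriv_mul, map_add, map_mul, map_mul]
  | add x y hx hy => simp only [map_add, hx, hy]

theorem symDeriv_prod (w : L) {n : ℕ} (v : Fin n → L) :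
    symDeriv w (∏ i, SymmetricAlgebra.ι k L (v i)) =
      ∑ i, ∏ j, SymmetricAlgebra.ι k L (Function.update v i (w * v i) j) := by
  rw [← algHom_tprod, symDeriv_algHom, tensorDeriv_tprod, map_sum]
  simp only [algHom_tprod]

theorem algebraMapInv_symDeriv (w : L) (P : SymmetricAlgebra k L) :
    SymmetricAlgebra.algebraMapInv (symDeriv w P) = 0 := by
  induction P using SymmetricAlgebra.induction with
  | algebraMap r => rw [symDeriv_algebraMap, map_zero]
  | ι v => rw [symDeriv_ι, SymmetricAlgebra.algebraMapInv_ι]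
  | mul a b ha hb => simp only [symDeriv_mul, map_add, map_mul, ha, hb, zero_mul, mul_zero, add_zero]
  | add a b ha hb => simp only [map_add, ha, hb, add_zero]

/-- Linear maps on `k[L]` that agree on monomials are equal. -/
theorem sym_ext {M : Type*} [AddCommGroup M] [Module k M] {f g : SymmetricAlgebra k L →ₗ[k] M}
    (h : ∀ n (v : Fin n → L), f (∏ i, SymmetricAlgebra.ι k L (v i)) =
      g (∏ i, SymmetricAlgebra.ι k L (v i))) : f = g := by
  have key : f ∘ₗ (SymmetricAlgebra.algHom k L).toLinearMap =
      g ∘ₗ (SymmetricAlgebra.algHom k L).toLinearMap :=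
    tensor_ext fun n v => by
      simpa only [LinearMap.comp_apply, AlgHom.toLinearMap_apply, algHom_tprod] using h n v
  ext P
  obtain ⟨t, rfl⟩ := SymmetricAlgebra.algHom_surjective k L P
  exact LinearMap.congr_fun key t

/-- Linear maps on `k[L]` that agree on `1` agree everywhere, provided that they agree on `w P`
whenever they agree on `P` and on the derivative of `P` along `w`. -/
theorem sym_ext_of_symDeriv {M : Type*} [AddCommGroup M] [Module k M]
    {f g : SymmetricAlgebra k L →ₗ[k] M} (h1 : f 1 = g 1)
    (h : ∀ w P, f P = g P → f (symDeriv w P) = g (symDeriv w P) →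
      f (SymmetricAlgebra.ι k L w * P) = g (SymmetricAlgebra.ι k L w * P)) : f = g := by
  refine sym_ext fun n => ?_
  induction n with
  | zero => intro v; simpa using h1
  | succ n ih =>
    intro v
    rw [Fin.prod_univ_succ]
    refine h _ _ (ih _) ?_
    -- `D_w` preserves degree, so it yields a sum of monomials of length `n`, all covered by the
    -- induction hypothesis.
    rw [symDeriv_prod, map_sum, map_sum]
    exact Finset.sum_congr rfl fun i _ => ih _

/-- `D_w` is a coderivation. Since `D_w ⊗ 1 + 1 ⊗ D_w` is a derivation of the tensor square, both
sides are derivations along the coproduct, and it is enough to compare them on primitive generators.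
-/
theorem comul_symDeriv (w : L) (P : SymmetricAlgebra k L) :
    Coalgebra.comul (R := k) (symDeriv w P) =
      (symDeriv w).rTensor _ (Coalgebra.comul (R := k) P) +
        (symDeriv w).lTensor _ (Coalgebra.comul (R := k) P) := by
  have der : ∀ x y : SymmetricAlgebra k L ⊗[k] SymmetricAlgebra k L,
      (symDeriv w).rTensor _ (x * y) + (symDeriv w).lTensor _ (x * y) =
        ((symDeriv w).rTensor _ x + (symDeriv w).lTensor _ x) * y +
          x * ((symDeriv w).rTensor _ y + (symDeriv w).lTensor _ y) := by
    intro x y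
    induction x using TensorProduct.induction_on with
    | zero => simp
    | add a b ha hb =>
      simp only [add_mul, map_add] at ha hb ⊢
      rw [add_add_add_comm, ha, hb]
      abel
    | tmul a b =>
      induction y using TensorProduct.induction_on with
      | zero => simp
      | add c d hc hd =>
        simp only [mul_add, map_add] at hc hd ⊢
        rw [add_add_add_comm, hc, hd]
        abel
      | tmul c d =>
        simp only [Algebra.TensorProduct.tmul_mul_tmul, LinearMap.rTensor_tmul,
          LinearMap.lTensor_tmul, symDeriv_mul, add_mul, mul_add, TensorProduct.add_tmul,
          TensorProduct.tmul_add]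
        abel
  induction P using SymmetricAlgebra.induction with
  | algebraMap r =>
    rw [symDeriv_algebraMap, Bialgebra.comul_algebraMap, Algebra.algebraMap_eq_smul_one,
      Algebra.TensorProduct.one_def]
    simp
  | ι v =>
    rw [symDeriv_ι, SymmetricAlgebra.comul_ι, SymmetricAlgebra.comul_ι]
    simp
  | mul a b ha hb => rw [symDeriv_mul, map_add, Bialgebra.comul_mul, Bialgebra.comul_mul,
      Bialgebra.comul_mul, der, ha, hb]
  | add a b ha hb =>
    simp only [map_add, ha, hb]
    abel

theorem counit_symDeriv (w : L) (P : SymmetricAlgebra k L) :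
    Coalgebra.counit (R := k) (symDeriv w P) = 0 := by
  induction P using SymmetricAlgebra.induction with
  | algebraMap r => rw [symDeriv_algebraMap, map_zero]
  | ι v => rw [symDeriv_ι, SymmetricAlgebra.counit_ι]
  | mul a b ha hb =>
    simp only [symDeriv_mul, map_add, Bialgebra.counit_mul, ha, hb, zero_mul, mul_zero, add_zero]
  | add a b ha hb => simp only [map_add, ha, hb, add_zero]

/-- The commutator `f ↦ D_w ∘ f - f ∘ D_w` is a derivation for convolution, because `D_w` is both a
derivation and a coderivation. The identity is written without subtraction. -/
theorem symDeriv_conv (w : L) (f g : WithConv (SymmetricAlgebra k L →ₗ[k] SymmetricAlgebra k L))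
    (P : SymmetricAlgebra k L) :
    symDeriv w ((f * g) P) + (toConv (f.ofConv ∘ₗ symDeriv w) * g) P +
        (f * toConv (g.ofConv ∘ₗ symDeriv w)) P =
      (f * g) (symDeriv w P) + (toConv (symDeriv w ∘ₗ f.ofConv) * g) P +
        (f * toConv (symDeriv w ∘ₗ g.ofConv)) P := by
  simp only [LinearMap.convMul_apply, comul_symDeriv]
  induction Coalgebra.comul (R := k) P using TensorProduct.induction_on with
  | zero => simp
  | tmul x y => simp [symDeriv_mul]; abel
  | add x y hx hy =>
    simp only [map_add] at hx hy ⊢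
    have := congrArg₂ (· + ·) hx hy
    rw [← sub_eq_zero] at this ⊢
    rw [← this]
    abel

theorem brace_ι_mul (w : L) (P : SymmetricAlgebra k L) :
    brace k L (SymmetricAlgebra.ι k L w * P) =
      leftMul k L w * brace k L P - brace k L (symDeriv w P) := by
  obtain ⟨t, rfl⟩ := SymmetricAlgebra.algHom_surjective k L P
  rw [symDeriv_algHom]
  exact tensorBrace_ι_mul k L w t

/-- Along `action`, both sides are derivations in `Q`: the left by `shift_mul`, the right by
`symDeriv_conv`. For `Q` a single vector the equality is the brace recursion `brace_ι_mul`. -/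
theorem shift_action (w : L) (Q : SymmetricAlgebra k L) :
    shift w (action k L Q) =
      toConv (symDeriv w ∘ₗ (action k L Q).ofConv) -
        toConv ((action k L Q).ofConv ∘ₗ symDeriv w) := by
  induction Q using SymmetricAlgebra.induction with
  | algebraMap r =>
    rw [Algebra.algebraMap_eq_smul_one, map_smul, map_one]
    ext P
    change r • shift w 1 P = symDeriv w (r • (1 : WithConv (_ →ₗ[k] _)) P) -
      r • (1 : WithConv (_ →ₗ[k] _)) (symDeriv w P)
    rw [shift_one, LinearMap.convOne_apply, LinearMap.convOne_apply, counit_symDeriv]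
    simp
  | ι v =>
    ext P
    change action k L (SymmetricAlgebra.ι k L v) (SymmetricAlgebra.ι k L w * P) =
      symDeriv w (action k L (SymmetricAlgebra.ι k L v) P) -
        action k L (SymmetricAlgebra.ι k L v) (symDeriv w P)
    simp only [action_ι_apply, symDeriv_ι, brace_ι_mul, LinearMap.sub_apply, map_sub,
      Module.End.mul_apply, leftMul_apply]
  | mul a b ha hb =>
    rw [map_mul, shift_mul, ha, hb, sub_mul, mul_sub]
    ext P
    have h := symDeriv_conv w (action k L a) (action k L b) P
    change ((toConv (symDeriv w ∘ₗ (action k L a).ofConv) * action k L b) P -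
        (toConv ((action k L a).ofConv ∘ₗ symDeriv w) * action k L b) P) +
      ((action k L a * toConv (symDeriv w ∘ₗ (action k L b).ofConv)) P -
        (action k L a * toConv ((action k L b).ofConv ∘ₗ symDeriv w)) P) =
      symDeriv w ((action k L a * action k L b) P) -
      (action k L a * action k L b) (symDeriv w P)
    rw [← sub_eq_zero] at h ⊢
    rw [← neg_eq_zero, ← h]
    abel
  | add a b ha hb =>
    rw [map_add]
    ext P
    have ha' := congrArg (fun f => f.ofConv P) ha
    have hb' := congrArg (fun f => f.ofConv P) hb
    change _ = symDeriv w (action k L a P) - action k L a (symDeriv w P) at ha'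
    change _ = symDeriv w (action k L b P) - action k L b (symDeriv w P) at hb'
    change (shift w (action k L a)).ofConv P + (shift w (action k L b)).ofConv P =
      symDeriv w (action k L a P + action k L b P) -
        (action k L a (symDeriv w P) + action k L b (symDeriv w P))
    rw [ha', hb', map_add]
    abel

/-- As `w` is primitive, it either stays outside as a factor or acts on exactly one factor of `P`.
-/
theorem ι_ogMul (w : L) (P : SymmetricAlgebra k L) :
    ogMul (SymmetricAlgebra.ι k L w) P = SymmetricAlgebra.ι k L w * P + symDeriv w P := by
  change (convId k L * action k L P) (SymmetricAlgebra.ι k L w) = _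
  have h := congrArg (fun f => f.ofConv 1) (shift_mul w (convId k L) (action k L P))
  change shift w (convId k L * action k L P) 1 =
    (shift w (convId k L) * action k L P) 1 +
      (convId k L * shift w (action k L P)) 1 at h
  rw [conv_apply_one, conv_apply_one, shift_apply, shift_apply, shift_apply, mul_one,
    action_apply_one, ← symDeriv_apply] at h
  rw [h]
  simp

/-- `(w P) ∗ Q = w ∗ (P ∗ Q) - (D_w P) ∗ Q`. -/
theorem ι_mul_ogMul (w : L) (P Q : SymmetricAlgebra k L) :
    ogMul (SymmetricAlgebra.ι k L w * P) Q =
      ogMul (SymmetricAlgebra.ι k L w) (ogMul P Q) - ogMul (symDeriv w P) Q := by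
  rw [ι_ogMul]
  -- Shifting the identity gives multiplication by `w`, which factors out of the convolution.
  have h1 : ∀ g : WithConv (SymmetricAlgebra k L →ₗ[k] SymmetricAlgebra k L),
      (shift w (convId k L) * g) P =
        SymmetricAlgebra.ι k L w * (convId k L * g) P := by
    intro g
    simp only [LinearMap.convMul_apply]
    induction Coalgebra.comul (R := k) P using TensorProduct.induction_on with
    | zero => simp
    | tmul x y => simp [shift, mul_assoc]
    | add x y hx hy => simp only [map_add, mul_add, hx, hy]
  have h2 := symDeriv_conv w (convId k L) (action k L Q) P
  change shift w (convId k L * action k L Q) P = SymmetricAlgebra.ι k L w *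
    (convId k L * action k L Q) P + symDeriv w ((convId k L * action k L Q) P) -
    (convId k L * action k L Q) (symDeriv w P)
  rw [shift_mul, shift_action, mul_sub, ← h1]
  -- For `f = id` the terms with `D_w ∘ f` and `f ∘ D_w` coincide and will cancel.
  simp only [LinearMap.id_comp, LinearMap.comp_id] at h2
  change (shift w (convId k L) * action k L Q) P +
    ((convId k L * toConv (symDeriv w ∘ₗ (action k L Q).ofConv)) P -
      (convId k L * toConv ((action k L Q).ofConv ∘ₗ symDeriv w)) P) = _
  rw [← sub_eq_zero] at h2 ⊢
  rw [← neg_eq_zero, ← h2]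
  abel

end Derivation

/-! ### Extending Lie algebra representations of `L` to `k[L]` with `∗` -/

section Representation

variable {k L U : Type*} [CommRing k] [LeftPreLieRing L] [LeftPreLieAlgebra k L] [Ring U]
  [Algebra k U]

/-- The direct sum of a pre-Lie algebra `L` and an algebra `U` on which `L` acts from the left
through `ρ`, equipped below with its pre-Lie product. -/
def SemidirectSum (_ρ : L →ₗ[k] U) : Type _ := L × U

namespace SemidirectSum

variable (ρ : L →ₗ[k] U)

instance : AddCommGroup (SemidirectSum ρ) := inferInstanceAs (AddCommGroup (L × U))

instance : Module k (SemidirectSum ρ) := inferInstanceAs (Module k (L × U))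

/-- The product `(a, x) ▷ (b, y) = (a ▷ b, ρ(a) y)`. -/
instance : Mul (SemidirectSum ρ) where
  mul p q := (p.1 * q.1, ρ p.1 * q.2)

instance : NonUnitalNonAssocRing (SemidirectSum ρ) where
  left_distrib p q r := Prod.ext (mul_add p.1 q.1 r.1) (mul_add (ρ p.1) q.2 r.2)
  right_distrib p q r := Prod.ext (add_mul p.1 q.1 r.1)
    ((congrArg (· * r.2) (map_add ρ p.1 q.1)).trans (add_mul (ρ p.1) (ρ q.1) r.2))
  zero_mul p := Prod.ext (zero_mul p.1) ((congrArg (· * p.2) (map_zero ρ)).trans (zero_mul p.2))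
  mul_zero p := Prod.ext (mul_zero p.1) (mul_zero (ρ p.1))

/-- The pre-Lie structure, given that `ρ` is a Lie algebra homomorphism. -/
abbrev leftPreLieRing (hρ : ∀ a b, ρ a * ρ b - ρ b * ρ a = ρ (a * b - b * a)) :
    LeftPreLieRing (SemidirectSum ρ) where
  assoc_symm' p q r := by
    refine Prod.ext (LeftPreLieRing.assoc_symm p.1 q.1 r.1) ?_
    change ρ (p.1 * q.1) * r.2 - ρ p.1 * (ρ q.1 * r.2) =
      ρ (q.1 * p.1) * r.2 - ρ q.1 * (ρ p.1 * r.2)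
    have h := congrArg (· * r.2) (hρ p.1 q.1)
    simp only [sub_mul, map_sub, mul_assoc] at h
    rw [← sub_eq_zero] at h ⊢
    rw [← neg_eq_zero, ← h]
    abel

/-- The pre-Lie product is bilinear. -/
abbrev leftPreLieAlgebra (hρ : ∀ a b, ρ a * ρ b - ρ b * ρ a = ρ (a * b - b * a)) :
    letI := leftPreLieRing ρ hρ
    LeftPreLieAlgebra k (SemidirectSum ρ) :=
  letI := leftPreLieRing ρ hρ
  { smul_assoc := fun c p q => Prod.ext (smul_mul_assoc c p.1 q.1)
      ((congrArg (· * q.2) (map_smul ρ c p.1)).trans (smul_mul_assoc c (ρ p.1) q.2))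
    smul_comm := fun c p q => Prod.ext (mul_smul_comm c p.1 q.1).symm
      (mul_smul_comm c (ρ p.1) q.2).symm }

end SemidirectSum

/-- A representation `ρ` of the Lie algebra of `L` extends to `k[L]` compatibly with the recursion
of the product `∗`. -/
theorem exists_extension (ρ : L →ₗ[k] U)
    (hρ : ∀ a b, ρ a * ρ b - ρ b * ρ a = ρ (a * b - b * a)) :
    ∃ Φ : SymmetricAlgebra k L →ₗ[k] U, Φ 1 = 1 ∧
      ∀ w P, Φ (SymmetricAlgebra.ι k L w * P) = ρ w * Φ P - Φ (symDeriv w P) := by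
  let _ := SemidirectSum.leftPreLieRing ρ hρ
  let _ := SemidirectSum.leftPreLieAlgebra ρ hρ
  let inl : L →ₗ[k] SemidirectSum ρ := LinearMap.inl k L U
  let snd : SemidirectSum ρ →ₗ[k] U := LinearMap.snd k L U
  let F : SymmetricAlgebra k L →ₐ[k] SymmetricAlgebra k (SemidirectSum ρ) :=
    SymmetricAlgebra.lift (SymmetricAlgebra.ι k _ ∘ₗ inl)
  have hF : ∀ v, F (SymmetricAlgebra.ι k L v) = SymmetricAlgebra.ι k _ (inl v) := fun v => by
    simp [F]
  have hinl : ∀ a b, inl a * inl b = inl (a * b) := fun a b =>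
    Prod.ext rfl (mul_zero (ρ a))
  have hD : ∀ w P, F (symDeriv w P) = symDeriv (inl w) (F P) := by
    intro w P
    induction P using SymmetricAlgebra.induction with
    | algebraMap r => rw [symDeriv_algebraMap, AlgHom.commutes, symDeriv_algebraMap, map_zero]
    | ι v => rw [symDeriv_ι, hF, hF, symDeriv_ι, hinl]
    | mul a b ha hb => simp only [symDeriv_mul, map_add, map_mul, ha, hb]
    | add a b ha hb => simp only [map_add, ha, hb]
  -- Since `(w, 0) ▷ (b, y) = (w ▷ b, ρ(w) y)`, the `U`-component of the brace of `F P` on `(0, 1)`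
  -- obeys the required recursion and starts at `1`. That the braces descend to symmetric
  -- polynomials supplies well-definedness.
  let e : SemidirectSum ρ := ((0, 1) : L × U)
  refine ⟨snd ∘ₗ (brace k (SemidirectSum ρ)).flip e ∘ₗ F.toLinearMap, ?_, fun w P => ?_⟩
  · simp only [LinearMap.comp_apply, AlgHom.toLinearMap_apply, map_one, LinearMap.flip_apply,
      brace_one]
    rfl
  · simp only [LinearMap.comp_apply, AlgHom.toLinearMap_apply, map_mul, hF, hD,
      LinearMap.flip_apply, brace_ι_mul, LinearMap.sub_apply, Module.End.mul_apply, map_sub]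
    rfl

/-- A linear map that is compatible with the recursion of `∗` is multiplicative for `∗`. -/
theorem map_ogMul_of_recursion {ρ : L → U} {Φ : SymmetricAlgebra k L →ₗ[k] U} (h1 : Φ 1 = 1)
    (h : ∀ w P, Φ (SymmetricAlgebra.ι k L w * P) = ρ w * Φ P - Φ (symDeriv w P))
    (P Q : SymmetricAlgebra k L) : Φ (ogMul P Q) = Φ P * Φ Q := by
  -- In terms of `∗`, the recursion says exactly that `Φ` is multiplicative when the left factor is
  -- a vector; the general left factor then follows from `ι_mul_ogMul`.
  have hι : ∀ w R, Φ (ogMul (SymmetricAlgebra.ι k L w) R) = ρ w * Φ R := fun w R => by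
    rw [ι_ogMul, map_add, h, sub_add_cancel]
  let rightMul : SymmetricAlgebra k L →ₗ[k] SymmetricAlgebra k L :=
    { toFun := fun P => ogMul P Q
      map_add' := fun P R => add_ogMul P R Q
      map_smul' := fun c P => smul_ogMul c P Q }
  have key : Φ ∘ₗ rightMul = LinearMap.mulRight k (Φ Q) ∘ₗ Φ := by
    refine sym_ext_of_symDeriv ?_ fun w P hP hD => ?_
    · change Φ (ogMul 1 Q) = Φ 1 * Φ Q
      rw [one_ogMul, h1, one_mul]
    · change Φ (ogMul P Q) = Φ P * Φ Q at hP
      change Φ (ogMul (symDeriv w P) Q) = Φ (symDeriv w P) * Φ Q at hD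
      change Φ (ogMul (SymmetricAlgebra.ι k L w * P) Q) = Φ (SymmetricAlgebra.ι k L w * P) * Φ Q
      rw [ι_mul_ogMul, map_sub, hι, hP, hD, h, sub_mul, mul_assoc]
  exact LinearMap.congr_fun key P

end Representation

end OudomGuin

/-! ### Recursions for time-ordered products -/

namespace ShuffleAlgebra

variable (k : Type*) {A : Type*} [CommRing k] [NonUnitalRing A] [Module k A] [ShuffleAlgebra k A]

/-- This compatibility and the next make the unitization of `A` a `k`-algebra; both come from
bilinearity of the half-products. -/
instance : IsScalarTower k A A where
  smul_assoc c a b := by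
    simp only [smul_eq_mul, mul_eq (k := k), map_smul, LinearMap.smul_apply, smul_add]

instance : SMulCommClass k A A where
  smul_comm c a b := by
    simp only [smul_eq_mul, mul_eq (k := k), map_smul, smul_add]

/-- `T[v_1, …, v_n] = ∑ p, v_p ≺ T[v_1, …, v_{p-1}, v_{p+1}, …, v_n]`. -/
theorem timeOrderedProduct_succ {n : ℕ} (v : Fin (n + 2) → A) :
    timeOrderedProduct k v =
      ∑ p, prec (k := k) (v p) (timeOrderedProduct k (p.removeNth v)) := by
  -- A permutation is encoded by its value `p` at `0` and the permutation `τ` induced on the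
  -- remaining positions: `decomposeFin.symm (0, τ)` fixes `0` and acts by `τ` on successors, then
  -- `p.cycleRange.symm` sends `0` to `p` and `j.succ` to `p.succAbove j`.
  let e : Fin (n + 2) × Equiv.Perm (Fin (n + 1)) → Equiv.Perm (Fin (n + 2)) := fun x =>
    x.1.cycleRange.symm * Equiv.Perm.decomposeFin.symm (0, x.2)
  have e0 : ∀ x, e x 0 = x.1 := fun x => by simp [e]
  have es : ∀ x j, e x (Fin.succ j) = x.1.succAbove (x.2 j) := fun x j => by simp [e]
  have he : Function.Bijective e := by
    rw [Fintype.bijective_iff_injective_and_card]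
    refine ⟨fun x y h => ?_, ?_⟩
    · have h0 : x.1 = y.1 := by rw [← e0 x, ← e0 y, h]
      refine Prod.ext h0 (Equiv.ext fun j => ?_)
      have h1 : e x j.succ = e y j.succ := by rw [h]
      rw [es, es, h0] at h1
      exact Fin.succAbove_right_injective h1
    · simp [Fintype.card_perm, Nat.factorial_succ]
  rw [timeOrderedProduct, ← he.sum_comp, Fintype.sum_prod_type]
  refine Finset.sum_congr rfl fun p _ => ?_
  rw [timeOrderedProduct, map_sum]
  refine Finset.sum_congr rfl fun σ _ => ?_
  rw [iteratedPrec]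
  simp only [Function.comp_apply, e0]
  congr 2
  ext j
  simp [Fin.tail, es, Fin.removeNth_apply]

theorem timeOrderedProduct_one (v : Fin 1 → A) : timeOrderedProduct k v = v 0 := by
  simp [timeOrderedProduct, iteratedPrec]

/-- `T[w, v_1, …, v_n] + ∑ i, T[v_1, …, w ▷ v_i, …, v_n] = w T[v_1, …, v_n]`. -/
theorem timeOrderedProduct_cons (w : A) : ∀ {n : ℕ} (v : Fin (n + 1) → A),
    timeOrderedProduct k (Fin.cons w v : Fin (n + 2) → A) +
        ∑ i, timeOrderedProduct k
          (Function.update v i (succ (k := k) w (v i) - prec (k := k) (v i) w)) =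
      w * timeOrderedProduct k v
  | 0, v => by
    -- With one vector: `(w ≺ v + v ≺ w) + (w ≻ v - v ≺ w) = w v`.
    rw [timeOrderedProduct_succ, Fin.sum_univ_succ]
    simp [timeOrderedProduct_one, Fin.removeNth_apply, mul_eq (k := k)]
  | n + 1, v => by
    -- Expand by the first letter, separating the modified letter `w ▷ v_i` from an unmodified `v_p`
    -- with `p ≠ i`.
    have h1 : ∀ i, timeOrderedProduct k
        (Function.update v i (succ (k := k) w (v i) - prec (k := k) (v i) w)) =
        prec (k := k) (succ (k := k) w (v i) - prec (k := k) (v i) w)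
          (timeOrderedProduct k (i.removeNth v)) +
        ∑ p ∈ Finset.univ.erase i, prec (k := k) (v p) (timeOrderedProduct k (p.removeNth
          (Function.update v i (succ (k := k) w (v i) - prec (k := k) (v i) w)))) := by
      intro i
      rw [timeOrderedProduct_succ, ← Finset.add_sum_erase _ _ (Finset.mem_univ i)]
      congr 1
      · simp
      · refine Finset.sum_congr rfl fun p hp => ?_
        rw [Function.update_of_ne (Finset.ne_of_mem_erase hp)]
    -- Exchanging the sums collects, behind a fixed first letter `v_p`, the modifications of all the
    -- other letters.
    have h2 : ∑ i, ∑ p ∈ Finset.univ.erase i, prec (k := k) (v p)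
          (timeOrderedProduct k (p.removeNth
            (Function.update v i (succ (k := k) w (v i) - prec (k := k) (v i) w)))) =
        ∑ p, prec (k := k) (v p) (∑ i, timeOrderedProduct k
          (Function.update (p.removeNth v) i
            (succ (k := k) w (p.removeNth v i) - prec (k := k) (p.removeNth v i) w))) := by
      rw [Finset.sum_comm' (t' := Finset.univ) (s' := fun p => Finset.univ.erase p)
        (by simp [eq_comm])]
      refine Finset.sum_congr rfl fun p _ => ?_
      rw [map_sum]
      -- The term `i = p` is added to both sides so that the left becomes a full sum over `i`, which
      -- can be reindexed through `p.succAbove`.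
      refine (add_left_cancel (a := prec (k := k) (v p) (timeOrderedProduct k (p.removeNth
        (Function.update v p (succ (k := k) w (v p) - prec (k := k) (v p) w))))) ?_)
      rw [Finset.add_sum_erase _ (fun i => prec (k := k) (v p) (timeOrderedProduct k (p.removeNth
        (Function.update v i (succ (k := k) w (v i) - prec (k := k) (v i) w)))))
        (Finset.mem_univ p), Fin.sum_univ_succAbove _ p]
      congr 1
      refine Finset.sum_congr rfl fun i _ => ?_
      rw [Fin.removeNth_update_succAbove, Fin.removeNth_apply]
    -- With `T` the product of the letters other than `v_p`, the induction hypothesis gives `v_p ≺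
    -- (w T) = (v_p ≺ w) ≺ T`. This cancels the negative half of `(w ▷ v_p) ≺ T` and leaves `(w ≻
    -- v_p) ≺ T = w ≻ (v_p ≺ T)`.
    have h3 : ∀ p : Fin (n + 2), prec (k := k) (v p)
          (timeOrderedProduct k (Fin.cons w (p.removeNth v) : Fin (n + 2) → A)) +
        (prec (k := k) (succ (k := k) w (v p) - prec (k := k) (v p) w)
          (timeOrderedProduct k (p.removeNth v)) +
        prec (k := k) (v p) (∑ i, timeOrderedProduct k (Function.update (p.removeNth v) i
            (succ (k := k) w (p.removeNth v i) - prec (k := k) (p.removeNth v i) w)))) =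
        succ (k := k) w (prec (k := k) (v p) (timeOrderedProduct k (p.removeNth v))) := by
      intro p
      rw [add_left_comm, ← map_add, timeOrderedProduct_cons w (p.removeNth v), map_sub,
        LinearMap.sub_apply, prec_prec, succ_prec, sub_add_cancel]
    have h4 : ∀ p : Fin (n + 2), p.succ.removeNth (Fin.cons w v : Fin (n + 3) → A) =
        (Fin.cons w (p.removeNth v) : Fin (n + 2) → A) := by
      intro p
      exact Fin.cons_comp_succ_succAbove _ _ _
    -- The words starting with `w` contribute `w ≺ T[v]`; the rest sum to `w ≻ T[v]` by `h3`.
    rw [timeOrderedProduct_succ, Fin.sum_univ_succ, Finset.sum_congr rfl fun i _ => h1 i,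
      Finset.sum_add_distrib, h2]
    simp only [Fin.cons_zero, Fin.cons_succ, Fin.removeNth_zero, Fin.tail_cons, h4]
    rw [add_assoc, ← Finset.sum_add_distrib, ← Finset.sum_add_distrib,
      Finset.sum_congr rfl fun p _ => h3 p, ← map_sum, ← timeOrderedProduct_succ, mul_eq (k := k)]

end ShuffleAlgebra

/-! ### Generation of `k[L]^+` by `L`, and uniqueness -/

namespace OudomGuin

namespace AugmentedPoly

variable {k L : Type*} [CommRing k] [LeftPreLieRing L] [LeftPreLieAlgebra k L]

variable (k L) in
/-- The projection `P ↦ P - P(0)` of `k[L]` onto `k[L]^+`. -/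
def proj : SymmetricAlgebra k L →ₗ[k] AugmentedPoly k L where
  toFun P := ⟨P - algebraMap k _ (SymmetricAlgebra.algebraMapInv P), by
    rw [augmentationIdeal, RingHom.mem_ker, map_sub, SymmetricAlgebra.algebraMap_leftInverse,
      sub_self]⟩
  map_add' P Q := Subtype.ext (by
    change P + Q - algebraMap k _ (SymmetricAlgebra.algebraMapInv (P + Q)) = (_ - _) + (_ - _)
    rw [map_add, map_add, add_sub_add_comm])
  map_smul' c P := Subtype.ext (by
    change c • P - algebraMap k _ (SymmetricAlgebra.algebraMapInv (c • P)) = c • (_ - _)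
    rw [map_smul, smul_eq_mul, map_mul, ← Algebra.smul_def, smul_sub])

theorem coe_proj (P : SymmetricAlgebra k L) :
    (proj k L P).1 = P - algebraMap k _ (SymmetricAlgebra.algebraMapInv P) := rfl

theorem ofVector_eq_monomial (v : L) : ofVector k v = monomial k fun _ : Fin 1 => v :=
  Subtype.ext (by
    change SymmetricAlgebra.ι k L v = ∏ _i : Fin 1, SymmetricAlgebra.ι k L v
    rw [Fin.prod_univ_one])

theorem proj_coe (P : AugmentedPoly k L) : proj k L P.1 = P := Subtype.ext (by
  have h : SymmetricAlgebra.algebraMapInv P.1 = 0 := P.2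
  rw [coe_proj, h, map_zero, sub_zero])

theorem proj_one : proj k L 1 = 0 := Subtype.ext (by
  rw [coe_proj, map_one, map_one, sub_self]
  rfl)

/-- This is `w P = w ∗ P - D_w P` rewritten inside `k[L]^+`. Splitting off the constant term of `P`
produces the multiple of `w`, since `w ∗ c = c w` for scalars `c`. -/
theorem proj_ι_mul (w : L) (P : SymmetricAlgebra k L) :
    proj k L (SymmetricAlgebra.ι k L w * P) =
      SymmetricAlgebra.algebraMapInv P • ofVector k w + ofVector k w * proj k L P -
        proj k L (symDeriv w P) := Subtype.ext (by
  change _ = (SymmetricAlgebra.algebraMapInv P • SymmetricAlgebra.ι k L w +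
    ogMul (SymmetricAlgebra.ι k L w) (proj k L P).1) - (proj k L (symDeriv w P)).1
  rw [ι_ogMul, coe_proj, coe_proj, coe_proj, algebraMapInv_symDeriv, map_mul,
    SymmetricAlgebra.algebraMapInv_ι, zero_mul, map_zero, map_sub, symDeriv_algebraMap,
    Algebra.smul_def]
  ring)

/-- Algebra maps on `k[L]^+` are determined by their values on `L`. -/
theorem hom_ext {A : Type*} [NonUnitalRing A] [Module k A] {φ ψ : AugmentedPoly k L →ₙₐ[k] A}
    (h : ∀ v, φ (ofVector k v) = ψ (ofVector k v)) : φ = ψ := by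
  have key : (φ : AugmentedPoly k L →ₗ[k] A) ∘ₗ proj k L =
      (ψ : AugmentedPoly k L →ₗ[k] A) ∘ₗ proj k L := by
    refine sym_ext_of_symDeriv ?_ fun w P hP hD => ?_
    · simp only [LinearMap.comp_apply, proj_one, map_zero]
    · change φ (proj k L P) = ψ (proj k L P) at hP
      change φ (proj k L (symDeriv w P)) = ψ (proj k L (symDeriv w P)) at hD
      change φ (proj k L _) = ψ (proj k L _)
      rw [proj_ι_mul, map_sub, map_sub, map_add, map_add, map_mul, map_mul, map_smul, map_smul,
        h, hP, hD]
  refine NonUnitalAlgHom.ext fun P => ?_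
  rw [← proj_coe P]
  exact LinearMap.congr_fun key P.1

end AugmentedPoly

end OudomGuin

/-! ### The canonical map, built in the unitization of `V` -/

namespace ShuffleAlgebra

open OudomGuin

variable (k V : Type*) [CommRing k] [NonUnitalRing V] [Module k V] [ShuffleAlgebra k V]

/-- The action of `V` on its unitization by left multiplication. -/
def unitizationRep : PreLie k V →ₗ[k] Unitization k V :=
  Unitization.inrHom k k V ∘ₗ (toPreLie k V).symm.toLinearMap

variable {V}

theorem unitizationRep_toPreLie (v : V) :
    unitizationRep k V (toPreLie k V v) = (v : Unitization k V) := rfl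

/-- The commutator of `▷` is that of the associative product: `(a ≻ b - b ≺ a) - (b ≻ a - a ≺ b) = a
b - b a`. -/
theorem unitizationRep_bracket (a b : PreLie k V) :
    unitizationRep k V a * unitizationRep k V b - unitizationRep k V b * unitizationRep k V a =
      unitizationRep k V (a * b - b * a) := by
  obtain ⟨a, rfl⟩ := (toPreLie k V).surjective a
  obtain ⟨b, rfl⟩ := (toPreLie k V).surjective b
  simp only [toPreLie_mul, ← map_sub, unitizationRep_toPreLie, ← Unitization.inr_mul,
    ← Unitization.inr_sub]
  congr 1
  simp only [mul_eq (k := k)]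
  abel

section Recursion

variable {k} {Φ : SymmetricAlgebra k (PreLie k V) →ₗ[k] Unitization k V}
  (h1 : Φ 1 = 1) (h : ∀ w P, Φ (SymmetricAlgebra.ι k _ w * P) =
    unitizationRep k V w * Φ P - Φ (symDeriv w P))

include h1 h

/-- The scalar part of `ρ(w)` is zero, so the recursion makes the scalar part of `Φ` vanish in
positive degree. Hence `Φ` sends `k[V]^+` into `V`. -/
theorem fst_of_recursion (P : SymmetricAlgebra k (PreLie k V)) :
    (Φ P).fst = SymmetricAlgebra.algebraMapInv P := by
  have key : (Unitization.fstHom k V).toLinearMap ∘ₗ Φ =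
      (SymmetricAlgebra.algebraMapInv (R := k) (M := PreLie k V)).toLinearMap := by
    refine sym_ext_of_symDeriv ?_ fun w P _ hD => ?_
    · simp [h1]
    · simp only [LinearMap.comp_apply, AlgHom.toLinearMap_apply, algebraMapInv_symDeriv] at hD ⊢
      rw [h, map_sub, hD, map_mul, map_mul, SymmetricAlgebra.algebraMapInv_ι, zero_mul, sub_zero]
      exact zero_mul _
  exact LinearMap.congr_fun key P

/-- Taking the first factor as `w`, the recursion for `Φ` and `timeOrderedProduct_cons` express both
sides in the same way through `n + 1` factors. -/
theorem prod_of_recursion : ∀ (n : ℕ) (v : Fin (n + 1) → V),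
    Φ (∏ i, SymmetricAlgebra.ι k _ (toPreLie k V (v i))) =
      ((timeOrderedProduct k v : V) : Unitization k V)
  | 0, v => by
    rw [Fin.prod_univ_succ, h, Fin.prod_univ_zero, symDeriv_one, h1, map_zero, mul_one, sub_zero,
      timeOrderedProduct_one, unitizationRep_toPreLie]
  | n + 1, v => by
    have hu : ∀ i : Fin (n + 1), ∏ j, SymmetricAlgebra.ι k (PreLie k V)
        (Function.update (fun l : Fin (n + 1) => toPreLie k V (v l.succ)) i
          (toPreLie k V (v 0) * toPreLie k V (v i.succ)) j) =
        ∏ j, SymmetricAlgebra.ι k _ (toPreLie k V (Function.update (Fin.tail v) i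
          (succ (k := k) (v 0) (v i.succ) - prec (k := k) (v i.succ) (v 0)) j)) := by
      intro i
      refine Finset.prod_congr rfl fun j _ => ?_
      by_cases hj : j = i
      · subst hj
        rw [Function.update_self, Function.update_self, toPreLie_mul]
      · rw [Function.update_of_ne hj, Function.update_of_ne hj]
        rfl
    have hT := timeOrderedProduct_cons k (v 0) (Fin.tail v)
    rw [Fin.cons_self_tail] at hT
    rw [Fin.prod_univ_succ, h, symDeriv_prod, map_sum]
    simp only [hu, prod_of_recursion n]
    rw [unitizationRep_toPreLie, ← Unitization.inr_mul,
      eq_sub_of_add_eq hT]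
    exact ((map_sub (Unitization.inrHom k k V) _ _).trans
      (congrArg _ (map_sum (Unitization.inrHom k k V) _ _))).symm

end Recursion

/-- The canonical algebra map `k[V]^+ → V`, whose value on a monomial is the time-ordered product
of its factors. -/
theorem exists_canonicalMap : ∃ φ : AugmentedPoly k (PreLie k V) →ₙₐ[k] V,
    ∀ (n : ℕ) (v : Fin (n + 1) → V),
      φ (AugmentedPoly.monomial k fun i => toPreLie k V (v i)) = timeOrderedProduct k v := by
  obtain ⟨Φ, h1, h⟩ := exists_extension (unitizationRep k V) (unitizationRep_bracket k)
  -- Without constant term, `Φ P` has zero scalar part, so taking the `V`-component loses nothing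
  -- and respects products.
  have hΦ : ∀ P : AugmentedPoly k (PreLie k V), Φ P.1 = ((Φ P.1).snd : Unitization k V) := by
    intro P
    refine Unitization.ext ?_ rfl
    rw [fst_of_recursion h1 h]
    exact P.2
  refine ⟨{ toFun := fun P => (Φ P.1).snd
            map_smul' := fun c P => congrArg (fun x : Unitization k V => x.snd) (map_smul Φ c P.1)
            map_zero' := congrArg (fun x : Unitization k V => x.snd) (map_zero Φ)
            map_add' := fun P Q => congrArg (fun x : Unitization k V => x.snd) (map_add Φ P.1 Q.1)
            map_mul' := fun P Q => ?_ }, fun n v => ?_⟩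
  · rw [AugmentedPoly.coe_mul, map_ogMul_of_recursion h1 h, hΦ P, hΦ Q, ← Unitization.inr_mul]
    rfl
  · exact congrArg (fun x : Unitization k V => x.snd) (prod_of_recursion h1 h n v)

end ShuffleAlgebra

end

theorem mainTheorem4 {k : Type*} [Field k] [CharZero k] {V : Type*} [NonUnitalRing V] [Module k V]
    [ShuffleAlgebra k V] :
    ∃ φ : OudomGuin.AugmentedPoly k (ShuffleAlgebra.PreLie k V) →ₙₐ[k] V,
      (∀ v : V, φ (OudomGuin.AugmentedPoly.ofVector k (ShuffleAlgebra.toPreLie k V v)) = v) ∧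
      (∀ ψ : OudomGuin.AugmentedPoly k (ShuffleAlgebra.PreLie k V) →ₙₐ[k] V,
        (∀ v : V, ψ (OudomGuin.AugmentedPoly.ofVector k (ShuffleAlgebra.toPreLie k V v)) = v) →
          ψ = φ) ∧
      ∀ (n : ℕ) (v : Fin (n + 1) → V),
        φ (OudomGuin.AugmentedPoly.monomial k (fun i => ShuffleAlgebra.toPreLie k V (v i))) =
          ShuffleAlgebra.timeOrderedProduct k v := by
  obtain ⟨φ, hφ⟩ := ShuffleAlgebra.exists_canonicalMap (V := V) k
  have hv : ∀ v : V,
      φ (OudomGuin.AugmentedPoly.ofVector k (ShuffleAlgebra.toPreLie k V v)) = v := by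
    intro v
    have h := hφ 0 fun _ => v
    rw [ShuffleAlgebra.timeOrderedProduct_one] at h
    exact (congrArg φ (OudomGuin.AugmentedPoly.ofVector_eq_monomial _)).trans h
  refine ⟨φ, hv, fun ψ hψ => OudomGuin.AugmentedPoly.hom_ext fun v => ?_, hφ⟩
  obtain ⟨v, rfl⟩ := (ShuffleAlgebra.toPreLie k V).surjective v
  rw [hψ, hv]
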